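/- Let $n\ge 1$ and $m\ge 0$ be integers. The Yoke graph $Y_{n,m}$ is the simple graph whose vertices are all sequences $v=(v_0,v_1,\dots,v_m,v_{m+1})$ with $v_0,v_{m+1}\in\mathbb{Z}/n\mathbb{Z}$, $v_1,\dots,v_m\in\{0,1\}$ and $\sum_{i=0}^{m+1}v_i\equiv 0\pmod n$. Two distinct vertices $u,v$ are adjacent if there is $0\le i\le m$ such that $u_j=v_j$ for every $j\notin\{i,i+1\}$ and either $u_i=v_i+1$ and $u_{i+1}=v_{i+1}-1$, or $u_i=v_i-1$ and $u_{i+1}=v_{i+1}+1$; here the equations for the entries $0$ and $m+1$ are in $\mathbb{Z}/n\mathbb{Z}$ and those for the entries $1,\dots,m$ are in $\mathbb{Z}$. The diameter $\operatorname{diam}(G)$ of a connected finite graph $G$ is the maximal distance between two of its vertices. Then $Y_{n,m}$ is connected, and its diameter is as follows. 1. If $n=1$, then $\operatorname{diam}(Y_{n,m})=\binom{\lceil m/2\rceil+1}{2}+\binom{\lfloor m/2\rfloor+1}{2}$. 2. If $0\le m\le n$, then $\operatorname{diam}(Y_{n,m})=\left\lfloor\frac{n(m+1)}{2}\right\rfloor$.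 3. If $2\le n\le m$, let $d_0=\binom{\lfloor (m+n)/2\rfloor+1}{2}+\binom{\lceil (m-n)/2\rceil+1}{2}$. Then (a) if $2\mid (m-n)$ or $n\le\lceil\frac{m+1}{2}\rceil$, then $\operatorname{diam}(Y_{n,m})=d_0$; (b) otherwise, $\operatorname{diam}(Y_{n,m})=d_0+n-\lceil\frac{m+1}{2}\rceil$. -/

import Mathlib

/-- A vertex of the Yoke graph `Y_{n,m}`: a sequence `(v₀, v₁, …, v_m, v_{m+1})` with
`v₀, v_{m+1} ∈ ℤ/n` (the buckets `left` and `right`) and `v₁, …, v_m ∈ {0, 1}`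
(`mid k` is `v_{k+1}`), whose sum is `0` modulo `n`. -/
@[ext]
structure YokeVertex (n m : ℕ) where
  left : ZMod n
  mid : Fin m → Fin 2
  right : ZMod n
  sum_eq_zero : left + ∑ k, ((mid k : ℕ) : ZMod n) + right = 0

/-- The relation `u_j = v_j + d` for the entry with index `j ∈ {0, …, m+1}`: an equation in `ℤ/n`
for the two buckets `j = 0` and `j = m + 1`, and an equation in `ℤ` for the entries between. -/
def YokeVertex.EntryEqAdd {n m : ℕ} (u v : YokeVertex n m) (j : ℕ) (d : ℤ) : Prop :=
  (j = 0 → u.left = v.left + (d : ZMod n)) ∧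
  (∀ k : Fin m, j = (k : ℕ) + 1 → ((u.mid k : ℕ) : ℤ) = ((v.mid k : ℕ) : ℤ) + d) ∧
  (j = m + 1 → u.right = v.right + (d : ZMod n))

/-- Shifting a unit between the entries `i` and `i + 1` (to the left or to the right) of `v`
gives `u`; all other entries agree. -/
def YokeVertex.IsShift {n m : ℕ} (u v : YokeVertex n m) (i : ℕ) : Prop :=
  (∀ j : ℕ, j ≤ m + 1 → j ≠ i → j ≠ i + 1 → u.EntryEqAdd v j 0) ∧
  ((u.EntryEqAdd v i 1 ∧ u.EntryEqAdd v (i + 1) (-1)) ∨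
    (u.EntryEqAdd v i (-1) ∧ u.EntryEqAdd v (i + 1) 1))

/-- The Yoke graph `Y_{n,m}`. The condition `u ≠ v` only matters for `n = 1`, `m = 0`, where the
unique vertex would otherwise carry a loop; the graph is simple. -/
def yokeGraph (n m : ℕ) : SimpleGraph (YokeVertex n m) where
  Adj u v := u ≠ v ∧ ∃ i : ℕ, i ≤ m ∧ u.IsShift v i
  symm := ⟨by
    have key : ∀ (u v : YokeVertex n m) (j : ℕ) (d e : ℤ), d + e = 0 →
        u.EntryEqAdd v j d → v.EntryEqAdd u j e := by
      rintro u v j d e hde ⟨h1, h2, h3⟩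
      have hde' : (d : ZMod n) + (e : ZMod n) = 0 := by
        rw [← Int.cast_add, hde, Int.cast_zero]
      refine ⟨fun h => ?_, fun k hk => ?_, fun h => ?_⟩
      · rw [h1 h, add_assoc, hde', add_zero]
      · have := h2 k hk
        omega
      · rw [h3 h, add_assoc, hde', add_zero]
    rintro u v ⟨hne, i, hi, h0, h⟩
    refine ⟨hne.symm, i, hi, fun j hj hji hji' => key _ _ _ _ _ (by norm_num) (h0 j hj hji hji'), ?_⟩
    rcases h with ⟨ha, hb⟩ | ⟨ha, hb⟩
    · exact Or.inr ⟨key _ _ _ _ _ (by norm_num) ha, key _ _ _ _ _ (by norm_num) hb⟩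
    · exact Or.inl ⟨key _ _ _ _ _ (by norm_num) ha, key _ _ _ _ _ (by norm_num) hb⟩⟩
  loopless := ⟨fun _ h => h.1 rfl⟩

/-! Partial sums turn a vertex into an integer sequence `s 0, …, s m` with steps 0 or 1, unique up
to adding a multiple of `n`. A shift at `i` changes only `s i`, by ±1. Hence the distance between
vertices with lifts `s`, `t` is the minimum over `k` of `∑ |s i - t i - k * n|`. The differences `d
= s - t` are exactly the sequences with steps in {-1, 0, 1}, so the diameter is the maximum over
such `d` of the minimum over `k` of `∑ |d i - k * n|`.

For the upper bound (`exists_sum_abs_sub_le`), write `m = a + b` with `b ≤ a`. If `d` meets a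
multiple of `n` at an index in `[b, a]`, that multiple is close enough to all of `d`. Otherwise `d`
is trapped between two consecutive multiples on `[b, a]`, and the better of the two costs at most
their average. Extremal sequences are nearly constant at `n / 2`, or `-b, …, a`, or the latter kind
with a repeated middle value. -/

namespace YokeVertex

/-! ### Lifts of vertices to integer sequences -/

variable {n m : ℕ}

/-- `s` lifts `u` if `s 0, …, s m` are integers whose residues modulo `n` are the partial sums of
the entries of `u`, the consecutive differences being the entries `u₁, …, u_m` themselves. -/
def IsLift (u : YokeVertex n m) (s : ℕ → ℤ) : Prop :=
  (s 0 : ZMod n) = u.left ∧ ∀ k : Fin m, s (k + 1) = s k + ((u.mid k : ℕ) : ℤ)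

theorem IsLift.sum_mid {u : YokeVertex n m} {s : ℕ → ℤ} (h : u.IsLift s) :
    ∑ k, ((u.mid k : ℕ) : ℤ) = s m - s 0 := by
  rw [← Finset.sum_range_sub s m, Finset.sum_range]
  exact Finset.sum_congr rfl fun k _ => by rw [h.2 k]; ring

theorem IsLift.right_eq {u : YokeVertex n m} {s : ℕ → ℤ} (h : u.IsLift s) :
    u.right = -(s m : ZMod n) := by
  have h1 := congrArg (Int.cast : ℤ → ZMod n) h.sum_mid
  push_cast at h1
  have h2 := u.sum_eq_zero
  rw [h1, ← h.1] at h2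
  linear_combination h2

theorem exists_isLift (u : YokeVertex n m) : ∃ s, u.IsLift s := by
  obtain ⟨z, hz⟩ := ZMod.intCast_surjective u.left
  refine ⟨fun i => z + ∑ j ∈ Finset.range i, if h : j < m then ((u.mid ⟨j, h⟩ : ℕ) : ℤ) else 0,
    by simpa using hz, fun k => ?_⟩
  simp [Finset.sum_range_succ, add_assoc]

theorem exists_isLift_of_step (n : ℕ) {m : ℕ} {s : ℕ → ℤ}
    (hs : ∀ i < m, s (i + 1) = s i ∨ s (i + 1) = s i + 1) :
    ∃ u : YokeVertex n m, u.IsLift s := by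
  let f : Fin m → Fin 2 := fun k => if s (k + 1) = s k then 0 else 1
  have hf : ∀ k : Fin m, s (k + 1) = s k + ((f k : ℕ) : ℤ) := by
    intro k
    by_cases h : s (k + 1) = s k
    · simp [f, h]
    · simpa [f, h] using (hs k k.2).resolve_left h
  have hsum : ∑ k, ((f k : ℕ) : ℤ) = s m - s 0 := by
    rw [← Finset.sum_range_sub s m, Finset.sum_range]
    exact Finset.sum_congr rfl fun k _ => by rw [hf k]; ring
  have hsum' := congrArg (Int.cast : ℤ → ZMod n) hsum
  push_cast at hsum'
  exact ⟨⟨s 0, f, -(s m : ZMod n), by rw [hsum']; ring⟩, rfl, hf⟩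

theorem IsLift.step {u : YokeVertex n m} {s : ℕ → ℤ} (h : u.IsLift s) {i : ℕ} (hi : i < m) :
    s (i + 1) = s i ∨ s (i + 1) = s i + 1 := by
  have h1 := h.2 ⟨i, hi⟩
  have h2 := (u.mid ⟨i, hi⟩).2
  simp only at h1
  omega

theorem IsLift.eq {u v : YokeVertex n m} {s t : ℕ → ℤ} (hu : u.IsLift s) (hv : v.IsLift t)
    (h : ∀ i ≤ m, s i = t i) : u = v := by
  ext k
  · rw [← hu.1, ← hv.1, h 0 (Nat.zero_le _)]
  · have h1 := hu.2 k
    have h2 := hv.2 k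
    rw [h _ k.2.le, h (k + 1) k.2] at h1
    omega
  · rw [hu.right_eq, hv.right_eq, h m le_rfl]

theorem IsLift.exists_eq_add_mul {u : YokeVertex n m} {s t : ℕ → ℤ} (hs : u.IsLift s)
    (ht : u.IsLift t) : ∃ k : ℤ, ∀ i ≤ m, s i = t i + k * n := by
  obtain ⟨k, hk⟩ := (ZMod.intCast_eq_intCast_iff_dvd_sub (t 0) (s 0) n).1 (ht.1.trans hs.1.symm)
  refine ⟨k, fun i => ?_⟩
  induction i with
  | zero => intro _; linear_combination hk
  | succ i ih =>
    intro hi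
    have h1 := hs.2 ⟨i, hi⟩
    have h2 := ht.2 ⟨i, hi⟩
    simp only at h1 h2
    linear_combination h1 - h2 + ih (by omega)

/-! ### Shifts and walks in terms of lifts -/

theorem isShift_iff {u v : YokeVertex n m} {i : ℕ} : u.IsShift v i ↔
    (∀ j : ℕ, j ≤ m + 1 → j ≠ i → j ≠ i + 1 → u.EntryEqAdd v j 0) ∧
    ∃ e : ℤ, |e| = 1 ∧ u.EntryEqAdd v i e ∧ u.EntryEqAdd v (i + 1) (-e) := by
  refine and_congr_right fun _ => ⟨?_, ?_⟩
  · rintro (h | h)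
    exacts [⟨1, by norm_num, h⟩, ⟨-1, by norm_num, by simpa using h⟩]
  · rintro ⟨e, he, h⟩
    rcases eq_or_eq_neg_of_abs_eq he with rfl | rfl
    exacts [Or.inl h, Or.inr (by simpa using h)]

theorem IsShift.exists_isLift {u v : YokeVertex n m} {i : ℕ} (hi : i ≤ m) (h : u.IsShift v i)
    {s : ℕ → ℤ} (hs : u.IsLift s) :
    ∃ t, v.IsLift t ∧ ∑ j ∈ Finset.range (m + 1), |s j - t j| = 1 := by
  obtain ⟨h0, e, he, h1, h2⟩ := isShift_iff.1 h
  refine ⟨fun j => s j - if j = i then e else 0, ⟨?_, fun k => ?_⟩, ?_⟩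
  · by_cases hi0 : i = 0
    · have := h1.1 hi0
      simp only [hi0, if_true]
      push_cast
      rw [hs.1, this]
      ring
    · have := (h0 0 (by omega) (by omega) (by omega)).1 rfl
      simp only [Ne.symm hi0, if_false]
      simpa [hs.1] using this
  · have hk := hs.2 k
    rcases lt_trichotomy ((k : ℕ) + 1) i with hlt | heq | hgt
    · have := (h0 (k + 1) (by omega) (by omega) (by omega)).2.1 k rfl
      simp only [hlt.ne, if_false, show (k : ℕ) ≠ i by omega]
      omega
    · have := h1.2.1 k heq.symm
      simp only [heq, if_true, show (k : ℕ) ≠ i by omega, if_false]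
      rw [← heq]
      omega
    · by_cases hki : (k : ℕ) = i
      · have := h2.2.1 k (by omega)
        simp only [hki, if_true]
        rw [← hki]
        omega
      · have := (h0 (k + 1) (by omega) (by omega) (by omega)).2.1 k rfl
        simp only [hgt.ne', if_false, hki]
        omega
  · rw [Finset.sum_eq_single i]
    · simpa using he
    · intro j _ hj
      simp [hj]
    · intro hni
      exact absurd (Finset.mem_range.2 (by omega)) hni

theorem IsLift.isShift {u v : YokeVertex n m} {s t : ℕ → ℤ} (hu : u.IsLift s) (hv : v.IsLift t)
    {i : ℕ} (him : i ≤ m) (hst : ∀ j ≤ m, j ≠ i → s j = t j) {e : ℤ} (he : |e| = 1)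
    (hi : s i = t i + e) : u.IsShift v i := by
  have hall : ∀ j ≤ m, s j = t j + if j = i then e else 0 := by
    intro j hj
    split_ifs with h
    · rw [h, hi]
    · rw [hst j hj h, add_zero]
  have key : ∀ j : ℕ, ∀ d : ℤ,
      (d = (if j = i then e else 0) - if j = i + 1 then e else 0) → u.EntryEqAdd v j d := by
    rintro j d rfl
    refine ⟨?_, ?_, ?_⟩
    · rintro rfl
      rw [← hu.1, ← hv.1, hall 0 (Nat.zero_le _)]
      simp
    · rintro k rfl
      have h1 := hu.2 k
      have h2 := hv.2 k
      rw [hall _ k.2.le, hall (k + 1) k.2] at h1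
      simp only [Nat.add_right_cancel_iff]
      linarith
    · rintro rfl
      rw [hu.right_eq, hv.right_eq, hall m le_rfl]
      simp only [Nat.add_right_cancel_iff, show m + 1 ≠ i by omega, if_false]
      push_cast
      ring
  refine isShift_iff.2 ⟨fun j _ h1 h2 => key j 0 (by simp [h1, h2]), e, he, key _ _ (by simp),
    key _ _ (by simp)⟩

theorem exists_isLift_of_walk {u v : YokeVertex n m} (p : (yokeGraph n m).Walk u v) :
    ∀ {s : ℕ → ℤ}, u.IsLift s →
      ∃ t, v.IsLift t ∧ ∑ i ∈ Finset.range (m + 1), |s i - t i| ≤ p.length := by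
  induction p with
  | nil => exact fun {s} hs => ⟨s, hs, by simp⟩
  | cons h p ih =>
    intro s hs
    obtain ⟨i, hi, hshift⟩ := h.2
    obtain ⟨t, ht, hst⟩ := hshift.exists_isLift hi hs
    obtain ⟨r, hr, htr⟩ := ih ht
    refine ⟨r, hr, ?_⟩
    have : ∑ i ∈ Finset.range (m + 1), |s i - r i| ≤
        ∑ i ∈ Finset.range (m + 1), (|s i - t i| + |t i - r i|) :=
      Finset.sum_le_sum fun i _ => abs_sub_le _ _ _
    rw [Finset.sum_add_distrib] at this
    simp only [SimpleGraph.Walk.length_cons]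
    push_cast
    linarith

/-- Some `s i` above `t i` can be lowered while all steps stay 0 or 1. The alternative `u = w`
occurs only for `n = 1`, `m = 0`. -/
theorem IsLift.exists_closer {u v : YokeVertex n m} {s t : ℕ → ℤ} (hu : u.IsLift s)
    (hv : v.IsLift t) (h : ∃ i ≤ m, t i < s i) :
    ∃ (w : YokeVertex n m) (r : ℕ → ℤ), w.IsLift r ∧ (u = w ∨ (yokeGraph n m).Adj u w) ∧
      ∑ i ∈ Finset.range (m + 1), |s i - t i| =
        ∑ i ∈ Finset.range (m + 1), |r i - t i| + 1 := by
  obtain ⟨i₀, hi₀, hlt₀⟩ := h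
  -- The weight `2 * s i - i` rises by 1 on a step 1 and falls by 1 on a step 0. At a maximum, `s`
  -- therefore arrives by a step 1 and leaves by a step 0, apart from the ends: a neighbour with
  -- larger weight would also lie above `t`.
  obtain ⟨i, hi, hmax⟩ := Finset.exists_max_image
    ((Finset.range (m + 1)).filter fun i => t i < s i) (fun i => 2 * s i - i)
    ⟨i₀, by simp [hlt₀]; omega⟩
  simp only [Finset.mem_filter, Finset.mem_range] at hi hmax
  obtain ⟨him, hlt⟩ := hi
  let r : ℕ → ℤ := fun j => s j - if j = i then 1 else 0
  have hstep : ∀ j < m, r (j + 1) = r j ∨ r (j + 1) = r j + 1 := by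
    intro j hj
    have h1 := hu.step hj
    have h2 := hv.step hj
    have h3 := hmax j
    have h4 := hmax (j + 1)
    simp only [r]
    push_cast at h4
    split_ifs with ha hb hb
    · omega
    · subst ha
      push_cast at h3
      omega
    · subst hb
      omega
    · omega
  obtain ⟨w, hw⟩ := exists_isLift_of_step n hstep
  refine ⟨w, r, hw, ?_, ?_⟩
  · by_cases huw : u = w
    · exact Or.inl huw
    · have him' : i ≤ m := by omega
      refine Or.inr ⟨huw, i, him', hu.isShift hw him' (e := 1) ?_ (by simp) (by simp [r])⟩
      intro j _ hj
      simp [r, hj]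
  · rw [← sub_eq_iff_eq_add', ← Finset.sum_sub_distrib, Finset.sum_eq_single i]
    · simp only [r, if_true]
      rw [abs_of_pos (by omega), abs_of_nonneg (by omega)]
      ring
    · intro j _ hj
      simp [r, hj]
    · intro hni
      exact absurd (Finset.mem_range.2 (by omega)) hni

theorem IsLift.exists_walk {u v : YokeVertex n m} {s t : ℕ → ℤ} (hu : u.IsLift s)
    (hv : v.IsLift t) : ∃ p : (yokeGraph n m).Walk u v,
      (p.length : ℤ) ≤ ∑ i ∈ Finset.range (m + 1), |s i - t i| := by
  suffices H : ∀ (N : ℕ) (u v : YokeVertex n m) (s t : ℕ → ℤ), u.IsLift s → v.IsLift t →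
      ∑ i ∈ Finset.range (m + 1), |s i - t i| = N →
      ∃ p : (yokeGraph n m).Walk u v, p.length ≤ N by
    obtain ⟨N, hN⟩ := Int.eq_ofNat_of_zero_le
      (Finset.sum_nonneg fun i (_ : i ∈ Finset.range (m + 1)) => abs_nonneg (s i - t i))
    obtain ⟨p, hp⟩ := H N u v s t hu hv hN
    exact ⟨p, by rw [hN]; exact_mod_cast hp⟩
  intro N
  have extend : ∀ {u w v : YokeVertex n m} {N : ℕ}, (u = w ∨ (yokeGraph n m).Adj u w) →
      (∃ p : (yokeGraph n m).Walk w v, p.length ≤ N) →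
      ∃ p : (yokeGraph n m).Walk u v, p.length ≤ N + 1 := by
    rintro u w v N (rfl | h) ⟨p, hp⟩
    · exact ⟨p, by omega⟩
    · exact ⟨.cons h p, by simpa using hp⟩
  induction N with
  | zero =>
    intro u v s t hu hv h
    have h0 := (Finset.sum_eq_zero_iff_of_nonneg fun i _ => abs_nonneg _).1 h
    obtain rfl : u = v := hu.eq hv fun i hi =>
      sub_eq_zero.1 (abs_eq_zero.1 (h0 i (Finset.mem_range.2 (by omega))))
    exact ⟨.nil, le_rfl⟩
  | succ N ih =>
    intro u v s t hu hv h
    by_cases h1 : ∃ i ≤ m, t i < s i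
    · obtain ⟨w, r, hw, huw, hr⟩ := hu.exists_closer hv h1
      exact extend huw (ih w v r t hw hv (by push_cast at h; linarith))
    by_cases h2 : ∃ i ≤ m, s i < t i
    · obtain ⟨w, r, hw, hvw, hr⟩ := hv.exists_closer hu h2
      simp only [abs_sub_comm (t _)] at hr
      simp only [abs_sub_comm (r _)] at hr
      obtain ⟨p, hp⟩ := ih u w s r hu hw (by push_cast at h; linarith)
      obtain ⟨q, hq⟩ := extend hvw ⟨p.reverse, by simpa using hp⟩
      exact ⟨q.reverse, by simpa using hq⟩
    · push Not at h1 h2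
      obtain rfl : u = v := hu.eq hv fun i hi => le_antisymm (h1 i hi) (h2 i hi)
      exact ⟨.nil, Nat.zero_le _⟩

end YokeVertex

/-! ### Reduction of the diameter to integer sequences -/

theorem YokeVertex.nonempty (n m : ℕ) : Nonempty (YokeVertex n m) :=
  (YokeVertex.exists_isLift_of_step n (s := fun _ => 0) fun _ _ => Or.inl rfl).nonempty

theorem yokeGraph_ediam_le {n m D : ℕ}
    (h : ∀ d : ℕ → ℤ, (∀ i < m, |d (i + 1) - d i| ≤ 1) →
      ∃ k : ℤ, ∑ i ∈ Finset.range (m + 1), |d i - k * n| ≤ D) :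
    (yokeGraph n m).ediam ≤ D := by
  refine SimpleGraph.ediam_le_of_edist_le fun u v => ?_
  obtain ⟨s, hs⟩ := u.exists_isLift
  obtain ⟨t, ht⟩ := v.exists_isLift
  obtain ⟨k, hk⟩ := h (fun i => s i - t i) fun i hi => by
    have h1 := hs.step hi
    have h2 := ht.step hi
    rw [abs_le]
    omega
  have ht' : v.IsLift fun i => t i + k * n :=
    ⟨by simpa using ht.1, fun j => by simp only [ht.2 j]; ring⟩
  obtain ⟨p, hp⟩ := hs.exists_walk ht'
  simp only [← sub_sub] at hp
  refine p.edist_le.trans ?_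
  exact_mod_cast hp.trans hk

theorem le_yokeGraph_diam {n m D : ℕ} (htop : (yokeGraph n m).ediam ≠ ⊤) {d : ℕ → ℤ}
    (hd : ∀ i < m, |d (i + 1) - d i| ≤ 1)
    (h : ∀ k : ℤ, D ≤ ∑ i ∈ Finset.range (m + 1), |d i - k * n|) :
    D ≤ (yokeGraph n m).diam := by
  have := YokeVertex.nonempty n m
  -- `t` collects the descents of `d`, so `t` and `d + t` both have steps 0 or 1.
  let t : ℕ → ℤ := fun i => ∑ j ∈ Finset.range i, max 0 (d j - d (j + 1))
  have ht : ∀ i, t (i + 1) = t i + max 0 (d i - d (i + 1)) := fun i => Finset.sum_range_succ _ _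
  obtain ⟨v, hv⟩ := YokeVertex.exists_isLift_of_step n (m := m) (s := t) fun i hi => by
    have h1 := abs_le.1 (hd i hi)
    have h2 := ht i
    omega
  obtain ⟨u, hu⟩ := YokeVertex.exists_isLift_of_step n (m := m) (s := fun i => d i + t i)
    fun i hi => by
      have h1 := abs_le.1 (hd i hi)
      have h2 := ht i
      omega
  refine le_trans ?_ (SimpleGraph.dist_le_diam htop (u := u) (v := v))
  obtain ⟨p, hp⟩ :=
    (SimpleGraph.connected_of_ediam_ne_top htop).exists_walk_length_eq_dist u v
  obtain ⟨r, hr, hsum⟩ := YokeVertex.exists_isLift_of_walk p hu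
  obtain ⟨k, hk⟩ := hr.exists_eq_add_mul hv
  have h1 := h k
  rw [hp] at hsum
  have h2 : ∑ i ∈ Finset.range (m + 1), |d i + t i - r i| =
      ∑ i ∈ Finset.range (m + 1), |d i - k * n| :=
    Finset.sum_congr rfl fun i hi => by
      rw [hk i (by simpa [Nat.lt_succ_iff] using hi)]
      ring_nf
  rw [h2] at hsum
  exact_mod_cast h1.trans hsum

theorem yokeGraph_connected_and_diam_eq {n m D : ℕ}
    (hle : ∀ d : ℕ → ℤ, (∀ i < m, |d (i + 1) - d i| ≤ 1) →
      ∃ k : ℤ, ∑ i ∈ Finset.range (m + 1), |d i - k * n| ≤ D)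
    {d : ℕ → ℤ} (hd : ∀ i < m, |d (i + 1) - d i| ≤ 1)
    (hge : ∀ k : ℤ, D ≤ ∑ i ∈ Finset.range (m + 1), |d i - k * n|) :
    (yokeGraph n m).Connected ∧ (yokeGraph n m).diam = D := by
  have := YokeVertex.nonempty n m
  have h := yokeGraph_ediam_le hle
  have htop : (yokeGraph n m).ediam ≠ ⊤ := ne_top_of_le_ne_top (ENat.natCast_ne_top D) h
  exact ⟨SimpleGraph.connected_of_ediam_ne_top htop, le_antisymm
    (ENat.toNat_le_of_le_natCast h) (le_yokeGraph_diam htop hd hge)⟩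

/-! ### Sums of absolute values -/

theorem two_mul_choose_succ_two (a : ℕ) : 2 * (((a + 1).choose 2 : ℕ) : ℤ) = a * (a + 1) := by
  have h : 2 * (a + 1).choose 2 = a * (a + 1) := by
    rw [Nat.choose_two_right, Nat.mul_div_cancel' (Nat.even_mul_pred_self (a + 1)).two_dvd,
      Nat.add_sub_cancel, mul_comm]
  exact_mod_cast h

/-- Pair `i` with `m - i` and use `|x| + |y| = max |x + y| |x - y|`. The sum thus depends on `c`
only through `|m - 2c|`, monotonically. -/
theorem two_mul_sum_abs_sub (m : ℕ) (c : ℤ) :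
    2 * ∑ i ∈ Finset.range (m + 1), |(i : ℤ) - c| =
      ∑ i ∈ Finset.range (m + 1), max |(m : ℤ) - 2 * c| |(m : ℤ) - 2 * i| := by
  rw [two_mul]
  nth_rw 1 [← Finset.sum_range_reflect]
  rw [← Finset.sum_add_distrib]
  refine Finset.sum_congr rfl fun i hi => ?_
  have hi' := Finset.mem_range.1 hi
  rw [show ((m + 1 - 1 - i : ℕ) : ℤ) = (m : ℤ) - i by omega]
  simp only [abs_eq_max_neg]
  omega

theorem sum_abs_sub_le_sum_abs_sub {m : ℕ} {c c' : ℤ}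
    (h : |(m : ℤ) - 2 * c| ≤ |(m : ℤ) - 2 * c'|) :
    ∑ i ∈ Finset.range (m + 1), |(i : ℤ) - c| ≤ ∑ i ∈ Finset.range (m + 1), |(i : ℤ) - c'| := by
  have h1 := two_mul_sum_abs_sub m c
  have h2 := two_mul_sum_abs_sub m c'
  have h3 : ∑ i ∈ Finset.range (m + 1), max |(m : ℤ) - 2 * c| |(m : ℤ) - 2 * i| ≤
      ∑ i ∈ Finset.range (m + 1), max |(m : ℤ) - 2 * c'| |(m : ℤ) - 2 * i| :=
    Finset.sum_le_sum fun i _ => max_le_max_right _ h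
  linarith

theorem sum_abs_sub_eq (a b : ℕ) :
    ∑ i ∈ Finset.range (a + b + 1), |(i : ℤ) - b| =
      (((a + 1).choose 2 + (b + 1).choose 2 : ℕ) : ℤ) := by
  have h1 : ∀ M ≤ b, 2 * ∑ i ∈ Finset.range M, |(i : ℤ) - b| = M * (2 * b - M + 1) := by
    intro M
    induction M with
    | zero => simp
    | succ M ih =>
      intro hM
      rw [Finset.sum_range_succ, mul_add, ih (by omega), abs_of_nonpos (by omega)]
      push_cast
      ring
  have h2 : ∀ M : ℕ, 2 * ∑ i ∈ Finset.range M, |((b + i : ℕ) : ℤ) - b| = M * (M - 1) := by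
    intro M
    induction M with
    | zero => simp
    | succ M ih =>
      rw [Finset.sum_range_succ, mul_add, ih, abs_of_nonneg (by omega)]
      push_cast
      ring
  have h3 := h1 b le_rfl
  have h4 := h2 (a + 1)
  have h5 := two_mul_choose_succ_two a
  have h6 := two_mul_choose_succ_two b
  rw [show a + b + 1 = b + (a + 1) by omega, Finset.sum_range_add]
  push_cast at h3 h4 ⊢
  linarith

theorem two_mul_sum_max_zero {b M : ℕ} (h : b ≤ M) :
    2 * ∑ i ∈ Finset.range M, max 0 ((b : ℤ) - 1 - i) = b * (b - 1) := by
  have h1 : ∀ M ≤ b, 2 * ∑ i ∈ Finset.range M, max 0 ((b : ℤ) - 1 - i) = M * (2 * b - 1 - M) := by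
    intro M
    induction M with
    | zero => simp
    | succ M ih =>
      intro hM
      rw [Finset.sum_range_succ, mul_add, ih (by omega), max_eq_right (by omega)]
      push_cast
      ring
  induction M, h using Nat.le_induction with
  | base => rw [h1 b le_rfl]; ring
  | succ M hM ih => rw [Finset.sum_range_succ, mul_add, ih, max_eq_left (by omega)]; ring

/-! ### Upper bound -/

theorem abs_sub_le_of_step {d : ℕ → ℤ} {m : ℕ} (hd : ∀ i < m, |d (i + 1) - d i| ≤ 1) {i j : ℕ}
    (hi : i ≤ m) (hj : j ≤ m) : |d i - d j| ≤ |(i : ℤ) - j| := by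
  wlog hij : i ≤ j generalizing i j
  · rw [abs_sub_comm, abs_sub_comm (i : ℤ)]
    exact this hj hi (by omega)
  induction j, hij using Nat.le_induction with
  | base => simp
  | succ j hij ih =>
    have h1 := ih (by omega)
    have h2 := hd j (by omega)
    simp only [abs_eq_max_neg] at *
    omega

/-- A walk on `ℤ` with steps at most `1` that misses the multiples of `n` on `[b, a]` stays strictly
between two consecutive multiples there. -/
theorem exists_forall_between {d : ℕ → ℤ} {n a b : ℕ} (hn : 1 ≤ n)
    (hd : ∀ i < a, |d (i + 1) - d i| ≤ 1) (hab : b ≤ a)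
    (h : ∀ j, b ≤ j → j ≤ a → ∀ k : ℤ, d j ≠ k * n) :
    ∃ q : ℤ, ∀ j, b ≤ j → j ≤ a → q * n < d j ∧ d j < (q + 1) * n := by
  refine ⟨d b / n, fun j hj => ?_⟩
  induction j, hj using Nat.le_induction with
  | base =>
    intro _
    have h1 := h b le_rfl hab (d b / n)
    have h2 := Int.ediv_mul_le (d b) (b := (n : ℤ)) (by omega)
    have h3 := Int.lt_ediv_add_one_mul_self (d b) (b := (n : ℤ)) (by omega)
    exact ⟨lt_of_le_of_ne h2 h1.symm, h3⟩
  | succ j hj ih =>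
    intro hja
    have h1 := ih (by omega)
    have h2 := abs_le.1 (hd j (by omega))
    have h3 := h (j + 1) (by omega) hja (d b / n)
    have h4 := h (j + 1) (by omega) hja (d b / n + 1)
    omega

theorem exists_sum_abs_sub_le {d : ℕ → ℤ} {n a b : ℕ} (hn : 1 ≤ n) (hab : b ≤ a)
    (hd : ∀ i < a + b, |d (i + 1) - d i| ≤ 1) :
    ∃ k : ℤ, ∑ i ∈ Finset.range (a + b + 1), |d i - k * n| ≤
        (((a + 1).choose 2 + (b + 1).choose 2 : ℕ) : ℤ) ∨
      2 * ∑ i ∈ Finset.range (a + b + 1), |d i - k * n| ≤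
        n * (a + b + 1) + 2 * (b * (b - 1)) := by
  by_cases hex : ∃ j, b ≤ j ∧ j ≤ a ∧ ∃ k : ℤ, d j = k * n
  · obtain ⟨j, hbj, hja, k, hk⟩ := hex
    refine ⟨k, Or.inl ?_⟩
    rw [← sum_abs_sub_eq, ← hk]
    calc ∑ i ∈ Finset.range (a + b + 1), |d i - d j|
        ≤ ∑ i ∈ Finset.range (a + b + 1), |(i : ℤ) - j| :=
          Finset.sum_le_sum fun i hi => abs_sub_le_of_step hd
            (by have := Finset.mem_range.1 hi; omega) (by omega)
      _ ≤ _ := sum_abs_sub_le_sum_abs_sub (by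
          push_cast
          simp only [abs_eq_max_neg]
          omega)
  · push Not at hex
    obtain ⟨q, hq⟩ := exists_forall_between hn (fun i hi => hd i (by omega)) hab hex
    -- The two distances add up to `n` plus twice the overshoot of `d i` beyond the strip. As `d b`
    -- and `d a` lie strictly inside, the overshoot is at most `b - 1 - i` to the left of `b` and `i
    -- - a - 1` to the right of `a`.
    have hpt : ∀ i ∈ Finset.range (a + b + 1), |d i - q * n| + |d i - (q + 1) * n| ≤
        n + 2 * (max 0 ((b : ℤ) - 1 - i) + max 0 ((b : ℤ) - 1 - (a + b + 1 - 1 - i : ℕ))) := by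
      intro i hi
      have hi' := Finset.mem_range.1 hi
      have hb := hq b le_rfl hab
      have ha := hq a hab le_rfl
      have h1 := abs_sub_le_of_step hd (i := i) (j := b) (by omega) (by omega)
      have h2 := abs_sub_le_of_step hd (i := i) (j := a) (by omega) (by omega)
      have h3 := hq i
      simp only [add_mul, one_mul] at hb ha h3 ⊢
      simp only [abs_eq_max_neg] at h1 h2 ⊢
      generalize q * (n : ℤ) = y at *
      omega
    have hsum := Finset.sum_le_sum hpt
    simp only [Finset.sum_add_distrib, ← Finset.mul_sum] at hsum
    rw [Finset.sum_range_reflect (fun i : ℕ => max 0 ((b : ℤ) - 1 - i)), Finset.sum_const,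
      Finset.card_range, nsmul_eq_mul] at hsum
    have h5 := two_mul_sum_max_zero (b := b) (M := a + b + 1) (by omega)
    push_cast at hsum
    have h6 : (n : ℤ) * (a + b + 1) = (a + b + 1) * n := mul_comm _ _
    rcases le_total (∑ i ∈ Finset.range (a + b + 1), |d i - q * n|)
      (∑ i ∈ Finset.range (a + b + 1), |d i - (q + 1) * n|) with h | h
    · exact ⟨q, Or.inr (by linarith)⟩
    · exact ⟨q + 1, Or.inr (by linarith)⟩

/-! ### Lower bounds for the extremal sequences -/

/-- Since `0 ≤ a - b ≤ n`, no multiple of `n` is nearer than 0 to the midpoint `(a - b) / 2` of `-b,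
…, a`. -/
theorem le_sum_abs_sub_sub {n a b : ℕ} (hab : b ≤ a) (h : a ≤ b + n) (k : ℤ) :
    (((a + 1).choose 2 + (b + 1).choose 2 : ℕ) : ℤ) ≤
      ∑ i ∈ Finset.range (a + b + 1), |(i : ℤ) - b - k * n| := by
  simp only [sub_sub]
  rw [← sum_abs_sub_eq]
  apply sum_abs_sub_le_sum_abs_sub
  push_cast
  rcases le_or_gt k 0 with hk | hk
  · have : k * (n : ℤ) ≤ 0 := mul_nonpos_of_nonpos_of_nonneg hk (by omega)
    simp only [abs_eq_max_neg]
    omega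
  · have : (n : ℤ) ≤ k * n := le_mul_of_one_le_left (by omega) hk
    simp only [abs_eq_max_neg]
    omega

theorem le_abs_sub_mul_or (n : ℕ) (k : ℤ) :
    (∀ x : ℤ, x ≤ |x - k * n|) ∨ ∀ x : ℤ, n - x ≤ |x - k * n| := by
  rcases le_or_gt k 0 with hk | hk
  · have : k * (n : ℤ) ≤ 0 := mul_nonpos_of_nonpos_of_nonneg hk (by omega)
    exact Or.inl fun x => le_trans (by omega) (le_abs_self _)
  · have : (n : ℤ) ≤ k * n := le_mul_of_one_le_left (by omega) hk
    exact Or.inr fun x => le_trans (by omega) (neg_le_abs _)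

/-! ### The diameter in each range of parameters -/

theorem yokeGraph_connected_and_diam_of_le {n m : ℕ} (hn : 1 ≤ n) (hmn : m ≤ n) :
    (yokeGraph n m).Connected ∧ (yokeGraph n m).diam = n * (m + 1) / 2 := by
  refine yokeGraph_connected_and_diam_eq (fun d hd => ?_)
    -- Alternating `⌊n/2⌋` and `⌈n/2⌉` makes the sum exactly `⌊n(m+1)/2⌋`.
    (d := fun i => (((n + i % 2) / 2 : ℕ) : ℤ)) (fun i _ => ?_) fun k => ?_
  · obtain ⟨k, hk⟩ := exists_sum_abs_sub_le (b := 0) hn (Nat.zero_le m) hd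
    refine ⟨k, ?_⟩
    have h1 := two_mul_choose_succ_two m
    have h2 : (m : ℤ) * (m + 1) ≤ n * (m + 1) :=
      mul_le_mul_of_nonneg_right (by omega) (by omega)
    simp only [Nat.cast_zero, add_zero, zero_mul, mul_zero, zero_add,
      Nat.choose_eq_zero_of_lt one_lt_two] at hk
    push_cast
    rw [Int.le_ediv_iff_mul_le two_pos]
    rcases hk with hk | hk <;> linarith
  · rw [abs_le]
    omega
  · have hsum : ∀ M : ℕ, ∑ i ∈ Finset.range M, (n + i % 2) / 2 = n * M / 2 := by
      intro M
      induction M with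
      | zero => simp
      | succ M ih =>
        rw [Finset.sum_range_succ, ih, mul_add, mul_one]
        rcases Nat.even_or_odd' M with ⟨c, rfl | rfl⟩
        · rw [show n * (2 * c) = 2 * (n * c) by ring]
          omega
        · rw [show n * (2 * c + 1) = 2 * (n * c) + n by ring]
          omega
    have hsum' := congrArg (Nat.cast : ℕ → ℤ) (hsum (m + 1))
    rw [Nat.cast_sum] at hsum'
    rcases le_abs_sub_mul_or n k with h | h
    · rw [← hsum']
      exact Finset.sum_le_sum fun i _ => h _
    · refine le_trans ?_ (Finset.sum_le_sum fun i _ => h _)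
      rw [Finset.sum_sub_distrib, hsum', Finset.sum_const, Finset.card_range, nsmul_eq_mul]
      have : ((m + 1 : ℕ) : ℤ) * n = ((n * (m + 1) : ℕ) : ℤ) := by push_cast; ring
      rw [this]
      omega

/-- The last hypothesis makes the trapped case no worse than the other; the `+ 1` is harmless
because the sums are integers. -/
theorem yokeGraph_connected_and_diam_of_le_of_le {n a b D : ℕ} (hn : 1 ≤ n) (hab : b ≤ a)
    (han : a ≤ b + n) (hD : D = (a + 1).choose 2 + (b + 1).choose 2)
    (h : n * (a + b + 1) + 2 * (b * (b - 1)) ≤ (2 * D + 1 : ℤ)) :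
    (yokeGraph n (a + b)).Connected ∧ (yokeGraph n (a + b)).diam = D := by
  refine yokeGraph_connected_and_diam_eq (fun d hd => ?_) (d := fun i => (i : ℤ) - b)
    (fun i _ => by simp) (fun k => hD ▸ le_sum_abs_sub_sub hab han k)
  obtain ⟨k, hk | hk⟩ := exists_sum_abs_sub_le hn hab hd
  · exact ⟨k, hD ▸ hk⟩
  · exact ⟨k, by omega⟩

theorem sum_range_succ_ite_pred (f : ℕ → ℤ) {m p : ℕ} (hp : p < m) :
    ∑ i ∈ Finset.range (m + 1), f (if i ≤ p then i else i - 1) =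
      ∑ i ∈ Finset.range m, f i + f p := by
  induction m, hp using Nat.le_induction with
  | base =>
    rw [Finset.sum_range_succ]
    simp only [Nat.succ_eq_add_one, Nat.add_sub_cancel, show ¬ p + 1 ≤ p by omega, if_false]
    congr 1
    exact Finset.sum_congr rfl fun i hi => by
      rw [if_pos (Nat.lt_succ_iff.1 (Finset.mem_range.1 hi))]
  | succ m hm ih =>
    rw [Finset.sum_range_succ, ih, if_neg (by omega), Finset.sum_range_succ _ m,
      Nat.add_sub_cancel]
    ring

/-- The extremal sequence here runs through `-b, …, a` with the middle value `n / 2` repeated. -/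
theorem yokeGraph_connected_and_diam_of_eq_add {n a b : ℕ} (hn : 1 ≤ n) (han : a = b + n)
    (hb : b + 1 ≤ n / 2) :
    (yokeGraph n (a + b + 1)).Connected ∧
      (yokeGraph n (a + b + 1)).diam = (a + 1).choose 2 + (b + 1).choose 2 + n / 2 := by
  have ha2 := two_mul_choose_succ_two a
  have hb2 := two_mul_choose_succ_two b
  refine yokeGraph_connected_and_diam_eq (fun d hd => ?_)
    (d := fun i => ((if i ≤ b + n / 2 then i else i - 1 : ℕ) : ℤ) - b) (fun i _ => ?_) fun k => ?_
  -- Now the trapped case dominates: it gives exactly the claimed value, while the other exceeds the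
  -- binomial sum by only `b + 1 ≤ n / 2`.
  · obtain ⟨k, hk⟩ := exists_sum_abs_sub_le (a := a) (b := b + 1) hn (by omega) hd
    refine ⟨k, ?_⟩
    have hb3 := two_mul_choose_succ_two (b + 1)
    rw [← add_assoc] at hk
    push_cast at hk hb3 ⊢
    rcases hk with hk | hk
    · have : ((b + 1 : ℕ) : ℤ) ≤ ((n / 2 : ℕ) : ℤ) := by exact_mod_cast hb
      push_cast at this
      linarith
    · have h1 : (n : ℤ) * (a + (b + 1) + 1) + 2 * ((b + 1) * (b + 1 - 1)) =
          a * (a + 1) + b * (b + 1) + n := by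
        subst han
        push_cast
        ring
      omega
  · rw [abs_le]
    split_ifs <;> omega
  · rw [sum_range_succ_ite_pred (fun j => |(j : ℤ) - b - k * n|) (by omega)]
    have h1 := le_sum_abs_sub_sub (n := n) (show b ≤ a by omega) (by omega) k
    have h2 : ((n / 2 : ℕ) : ℤ) ≤ |((b + n / 2 : ℕ) : ℤ) - b - k * n| := by
      rw [show ((b + n / 2 : ℕ) : ℤ) - b = ((n / 2 : ℕ) : ℤ) by push_cast; ring]
      rcases le_abs_sub_mul_or n k with h | h
      · exact h _
      · exact le_trans (by omega) (h _)
    rw [Nat.cast_add]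
    exact add_le_add h1 h2

theorem yokeGraph_connected_and_diam_of_sub_le_half {n a b : ℕ} (hn : 1 ≤ n) (hab : b ≤ a)
    (h : a = b + n ∨ a + 1 = b + n ∧ n / 2 ≤ b) :
    (yokeGraph n (a + b)).Connected ∧
      (yokeGraph n (a + b)).diam = (a + 1).choose 2 + (b + 1).choose 2 := by
  refine yokeGraph_connected_and_diam_of_le_of_le hn hab (by omega) rfl ?_
  have ha2 := two_mul_choose_succ_two a
  have hb2 := two_mul_choose_succ_two b
  push_cast
  rcases h with rfl | ⟨h, hb⟩
  · have : (n : ℤ) * (((b + n : ℕ) : ℤ) + b + 1) + 2 * (b * (b - 1)) =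
        ((b + n : ℕ) : ℤ) * (((b + n : ℕ) : ℤ) + 1) + b * (b + 1) - 4 * b := by
      push_cast
      ring
    push_cast at this ha2 ⊢
    linarith
  · obtain rfl : n = a + 1 - b := by omega
    have : ((a + 1 - b : ℕ) : ℤ) * (a + b + 1) + 2 * (b * (b - 1)) =
        a * (a + 1) + b * (b + 1) + (((a + 1 - b : ℕ) : ℤ) - 2 * b) := by
      rw [Nat.cast_sub (by omega)]
      push_cast
      ring
    -- What remains is `n - 2 * b ≤ 1`, that is, `n / 2 ≤ b`.
    rw [this]
    omega

theorem mainTheorem1 (n m : ℕ) (hn : 1 ≤ n) :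
    (yokeGraph n m).Connected ∧
    (n = 1 →
      (yokeGraph n m).diam = (m ⌈/⌉ 2 + 1).choose 2 + (m / 2 + 1).choose 2) ∧
    (m ≤ n → (yokeGraph n m).diam = n * (m + 1) / 2) ∧
    (2 ≤ n → n ≤ m →
      ∀ d₀ : ℕ, d₀ = ((m + n) / 2 + 1).choose 2 + ((m - n) ⌈/⌉ 2 + 1).choose 2 →
      ((2 ∣ m - n ∨ n ≤ (m + 1) ⌈/⌉ 2) → (yokeGraph n m).diam = d₀) ∧
      (¬ (2 ∣ m - n ∨ n ≤ (m + 1) ⌈/⌉ 2) →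
        (yokeGraph n m).diam = d₀ + (n - (m + 1) ⌈/⌉ 2))) := by
  simp only [Nat.ceilDiv_eq_add_pred_div]
  have hbalanced : n ≤ m → (2 ∣ m - n ∨ n ≤ (m + 1 + 2 - 1) / 2) →
      (yokeGraph n m).Connected ∧ (yokeGraph n m).diam =
        ((m + n) / 2 + 1).choose 2 + ((m - n + 2 - 1) / 2 + 1).choose 2 := by
    intro hnm h
    have := yokeGraph_connected_and_diam_of_sub_le_half (n := n) (a := (m + n) / 2)
      (b := (m - n + 2 - 1) / 2) hn (by omega) (by omega)
    rwa [show (m + n) / 2 + (m - n + 2 - 1) / 2 = m by omega] at this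
  have hrepeated : n ≤ m → ¬ (2 ∣ m - n ∨ n ≤ (m + 1 + 2 - 1) / 2) →
      (yokeGraph n m).Connected ∧ (yokeGraph n m).diam =
        ((m + n) / 2 + 1).choose 2 + ((m - n + 2 - 1) / 2 + 1).choose 2 +
          (n - (m + 1 + 2 - 1) / 2) := by
    intro hnm h
    obtain ⟨b, hb⟩ : ∃ b, (m - n + 2 - 1) / 2 = b + 1 := ⟨(m - n + 2 - 1) / 2 - 1, by omega⟩
    have := yokeGraph_connected_and_diam_of_eq_add (n := n) (a := (m + n) / 2) (b := b) hn
      (by omega) (by omega)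
    rw [show (m + n) / 2 + b + 1 = m by omega] at this
    refine ⟨this.1, this.2.trans ?_⟩
    -- Here `d₀` is formed with `b + 1` in place of `b`; Pascal's rule gives the extra `b + 1`, and
    -- `b + 1 + (n - ⌈(m+1)/2⌉) = ⌊n/2⌋`.
    rw [hb, Nat.choose_succ_succ' (b + 1) 1, Nat.choose_one_right, one_add_one_eq_two]
    omega
  refine ⟨?_, ?_, fun h => (yokeGraph_connected_and_diam_of_le hn h).2, ?_⟩
  · by_cases hmn : m ≤ n
    · exact (yokeGraph_connected_and_diam_of_le hn hmn).1
    · by_cases h : 2 ∣ m - n ∨ n ≤ (m + 1 + 2 - 1) / 2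
      · exact (hbalanced (by omega) h).1
      · exact (hrepeated (by omega) h).1
  · rintro rfl
    have := yokeGraph_connected_and_diam_of_sub_le_half (n := 1) (a := (m + 2 - 1) / 2)
      (b := m / 2) le_rfl (by omega) (by omega)
    rw [show (m + 2 - 1) / 2 + m / 2 = m by omega] at this
    exact this.2
  · rintro - hnm d₀ rfl
    exact ⟨fun h => (hbalanced hnm h).2, fun h => (hrepeated hnm h).2⟩
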